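/- For $n\ge 2$ let $Q_n=\{1,\dots,n\}$. Transformations of $Q_n$ are denoted as follows: $\mathbf 1$ is the identity; $(p,p+1,\dots,q)$ is a cycle, fixing all other elements; $(p\to q)$ sends $p$ to $q$ and fixes all other elements; $(Q_m\to q)$ sends $1,\dots,m$ to $q$ and fixes $m+1,\dots,n$. Let $\mathcal D_n$ be the DFA with state set $Q_n$, initial state $1$, set of final states $\{n\}$, and letters acting on $Q_n$ as follows. * If $n\ge 4$: $\Sigma=\{a,b,c,d,e,f\}$ with $a=(2,3,\dots,n-1)$, $b=(2,3)$, $c=(n-1\to 2)$, $d=(n-1\to 1)$, $e=(Q_{n-1}\to 2)$, $f=(2\to n)$. * If $n=3$: $\Sigma=\{a,b,c,d\}$ with $a=\mathbf 1$, $b=(Q_2\to 2)$, $c=(2\to 3)$, $d=(2\to 1)$. * If $n=2$: $\Sigma=\{a,b\}$ with $a=\mathbf 1$, $b=(Q_2\to 2)$. Let $L_n$ be the language accepted by $\mathcal D_n$, and let $K_i$ be the set of words accepted from state $i$. The complexity $\kappa(L)$ of a language $L$ is the number of its distinct left quotients $w^{-1}L=\{v\mid wv\in L\}$, $w\in\Sigma^*$.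 An atom of $L$ is a non-empty intersection in which each quotient of $L$ occurs either uncomplemented or complemented. Theorem. For every $n\ge 2$, $L_n$ is a two-sided ideal, that is, $L_n=\Sigma^*L_n\Sigma^*$; it has complexity $n$, and its quotients are the pairwise distinct languages $K_1,\dots,K_n$. It has exactly $2^{n-2}+1$ atoms, and for every $S\subseteq Q_n$ such that $A_S=\bigcap_{i\in S}K_i\cap\bigcap_{i\in Q_n\setminus S}\overline{K_i}$ is an atom, $$\kappa(A_S)=\begin{cases} n, & S=Q_n;\\ 2^{n-2}+n-1, & S=Q_n\setminus\{1\};\\ 1+\sum_{x=1}^{|S|}\sum_{y=1}^{n-|S|}\binom{n-2}{x-1}\binom{n-x-1}{y-1}, & \text{otherwise.}\end{cases}$$ -/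

import Mathlib

namespace TwoSidedAtoms

/-- The set of (left) quotients `w⁻¹L` of a language. -/
def quotients {α : Type} (L : Language α) : Set (Language α) :=
  Set.range L.leftQuotient

/-- The (quotient) complexity `κ(L)`: the number of distinct quotients of `L`. -/
noncomputable def complexity {α : Type} (L : Language α) : ℕ∞ :=
  (quotients L).encard

/-- `L` is a two-sided ideal: `L = Σ* L Σ*`. -/
def IsTwoSidedIdeal {α : Type} (L : Language α) : Prop :=
  L = ⊤ * L * ⊤

/-- The atomic intersection `A_S = ⋂_{i ∈ S} K_i ∩ ⋂_{i ∉ S} (K_i)ᶜ` of a family of languages: the members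
with index in `S` are uncomplemented, the others are complemented. -/
def atomicIntersection {α ι : Type} (K : ι → Language α) (S : Set ι) : Language α :=
  {w | (∀ i ∈ S, w ∈ K i) ∧ ∀ i ∉ S, w ∉ K i}

/-- An atom of `L`: a non-empty atomic intersection of the quotients of `L`. -/
def IsAtomOf {α : Type} (L A : Language α) : Prop :=
  (∃ w, w ∈ A) ∧
    ∃ S : Set (quotients L), A = atomicIntersection (fun K : quotients L => (K : Language α)) S

/-- The state `k` of `Q_n = {1, …, n}`; the set `Q_n` is represented by `Fin n`. -/
def state (n k : ℕ) (h : 1 ≤ k ∧ k ≤ n) : Fin n :=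
  ⟨k - 1, by omega⟩

/-- The unitary transformation `(p → q)`. -/
def unitary {n : ℕ} (p q : Fin n) : Fin n → Fin n :=
  fun i => if i = p then q else i

/-- The transformation `(Q_m → q)`, which sends `1, …, m` to `q` and fixes `m + 1, …, n`. -/
def collapse {n : ℕ} (m : ℕ) (q : Fin n) : Fin n → Fin n :=
  fun i => if i.val + 1 ≤ m then q else i

/-- The cycle `(p, p + 1, …, q)`, for `p ≤ q`. -/
def cycle {n : ℕ} (p q : Fin n) : Fin n → Fin n :=
  fun i => if h : p ≤ i ∧ i < q then ⟨i.val + 1, by omega⟩ else if i = q then p else i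

inductive Letters2
  | a | b

inductive Letters4
  | a | b | c | d

inductive Letters6
  | a | b | c | d | e | f

/-- The alphabet of `D_n`: `{a, b}` for `n = 2`, `{a, b, c, d}` for `n = 3` and
`{a, b, c, d, e, f}` for `n ≥ 4`. -/
def Alphabet : ℕ → Type
  | 2 => Letters2
  | 3 => Letters4
  | _ => Letters6

/-- `D_n` for `n ≥ 4`. -/
def dfaLarge (n : ℕ) (hn : 4 ≤ n) : DFA Letters6 (Fin n) where
  step q x := match x with
    | .a => cycle (state n 2 (by omega)) (state n (n - 1) (by omega)) q
    | .b => Equiv.swap (state n 2 (by omega)) (state n 3 (by omega)) q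
    | .c => unitary (state n (n - 1) (by omega)) (state n 2 (by omega)) q
    | .d => unitary (state n (n - 1) (by omega)) (state n 1 (by omega)) q
    | .e => collapse (n - 1) (state n 2 (by omega)) q
    | .f => unitary (state n 2 (by omega)) (state n n (by omega)) q
  start := state n 1 (by omega)
  accept := {state n n (by omega)}

/-- `D_3`. -/
def dfa3 : DFA Letters4 (Fin 3) where
  step q x := match x with
    | .a => q
    | .b => collapse 2 (state 3 2 (by omega)) q
    | .c => unitary (state 3 2 (by omega)) (state 3 3 (by omega)) q
    | .d => unitary (state 3 2 (by omega)) (state 3 1 (by omega)) q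
  start := state 3 1 (by omega)
  accept := {state 3 3 (by omega)}

/-- `D_2`. -/
def dfa2 : DFA Letters2 (Fin 2) where
  step q x := match x with
    | .a => q
    | .b => collapse 2 (state 2 2 (by omega)) q
  start := state 2 1 (by omega)
  accept := {state 2 2 (by omega)}

/-- The DFA `D_n`, `n ≥ 2`. -/
def dfa : (n : ℕ) → 2 ≤ n → DFA (Alphabet n) (Fin n)
  | 0, h => absurd h (by omega)
  | 1, h => absurd h (by omega)
  | 2, _ => dfa2
  | 3, _ => dfa3
  | n + 4, _ => dfaLarge (n + 4) (by omega)

/-- The bound on the complexity of the atom `A_S` of a two-sided ideal of complexity `n`. -/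
def atomBound (n : ℕ) (hn : 2 ≤ n) (S : Finset (Fin n)) : ℕ :=
  if S = Finset.univ then n
  else if S = Finset.univ \ {state n 1 (by omega)} then 2 ^ (n - 2) + n - 1
  else 1 + ∑ x ∈ Finset.Icc 1 S.card, ∑ y ∈ Finset.Icc 1 (n - S.card),
    (n - 2).choose (x - 1) * (n - x - 1).choose (y - 1)

end TwoSidedAtoms

/-! Everything depends only on how words act on the states, so the three shapes of automaton are
reduced to `IsRich`, with `z` the sink. A word lies in `A_S` exactly when `S` is its preimage of
`z`. A word taking the start to `z` takes every state to `z`, so an atom has `S` everything, or `z ∈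
S` and the start outside `S`. All such sets occur, because every transformation fixing both states
is realized. The quotient of `A_S` by `w` is `pairLang` of the images of `S` and `Sᶜ`. It is empty
if these meet. If `w` fixes the start, they form a normal pair whose sizes are at most those of `S`
and `Sᶜ`, and all such pairs arise. Otherwise the images collapse to `{z}` and `{j}`; adding the
start to `{j}` does not change the language, so this too is a normal pair when `j` is not the start.
Distinct normal pairs give distinct nonempty languages (`pairLang_injOn`), so counting quotients is
counting pairs. The collapsed pairs are new only when `Sᶜ` is the start alone, which explains the
exceptional formula. It remains to generate the required transformations from the letters. -/

namespace TwoSidedAtoms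

/-! ### Atoms and their quotients for an abstract rich automaton. -/

section Abstract

set_option linter.unusedSectionVars false

variable {α Q : Type} [Fintype Q] [DecidableEq Q]

/-- The words of a DFA with sink final state `z` act on its states by transformations that fix `z`
and either fix the initial state or send every state to `z` or to the image of the initial state;
among them are all transformations that fix both states, and for each state `j` one that sends every
state but `z` to `j`. -/
structure IsRich (M : DFA α Q) (z : Q) : Prop where
  accept_eq : M.accept = {z}
  start_ne : M.start ≠ z
  sink : ∀ w, M.evalFrom z w = z
  dichotomy : ∀ w, M.evalFrom M.start w = M.start ∨
    ∀ q, M.evalFrom q w = M.evalFrom M.start w ∨ M.evalFrom q w = z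
  full : ∀ t : Q → Q, t M.start = M.start → t z = z → ∃ w, ∀ q, M.evalFrom q w = t q
  collapse : ∀ j, ∃ w, ∀ q, q ≠ z → M.evalFrom q w = j

/-- The words accepted from each state of `X` and from no state of `Y`. -/
def pairLang (M : DFA α Q) (X Y : Finset Q) : Language α :=
  {v | (∀ q ∈ X, v ∈ M.acceptsFrom q) ∧ ∀ q ∈ Y, v ∉ M.acceptsFrom q}

/-- The states other than the initial state and `z`. -/
def middle (M : DFA α Q) (z : Q) : Finset Q := Finset.univ \ {M.start, z}

theorem mem_middle {M : DFA α Q} {z q : Q} : q ∈ middle M z ↔ q ≠ M.start ∧ q ≠ z := by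
  simp [middle]

namespace IsRich

variable {M : DFA α Q} {z : Q}

theorem card_middle (h : IsRich M z) : (middle M z).card = Fintype.card Q - 2 := by
  rw [middle, Finset.card_sdiff_of_subset (Finset.subset_univ _), Finset.card_univ,
    Finset.card_pair h.start_ne]

theorem mem_acceptsFrom (h : IsRich M z) {q : Q} {w : List α} :
    w ∈ M.acceptsFrom q ↔ M.evalFrom q w = z := by
  rw [M.mem_acceptsFrom, h.accept_eq, Set.mem_singleton_iff]

/-- The dichotomy leaves no other value once the start has moved to `z`. This yields the ideal
property, the restriction on atoms and `pairLang_insert_start`. -/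
theorem evalFrom_eq_of_start (h : IsRich M z) {w : List α} (hw : M.evalFrom M.start w = z) (q : Q) :
    M.evalFrom q w = z := by
  rcases h.dichotomy w with h1 | h1
  · exact absurd (h1.symm.trans hw) h.start_ne
  · rcases h1 q with h2 | h2
    · exact h2.trans hw
    · exact h2

theorem isTwoSidedIdeal (h : IsRich M z) : IsTwoSidedIdeal M.accepts := by
  apply le_antisymm
  · intro w hw
    exact Language.mem_mul.2 ⟨w, Language.mem_mul.2 ⟨[], trivial, w, hw, rfl⟩, [], trivial, by simp⟩
  · intro w hw
    obtain ⟨uv, huv, x, -, rfl⟩ := Language.mem_mul.1 hw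
    obtain ⟨u, -, v, hv, rfl⟩ := Language.mem_mul.1 huv
    have hv' := h.mem_acceptsFrom.1 hv
    refine h.mem_acceptsFrom.2 ?_
    rw [M.evalFrom_of_append, M.evalFrom_of_append, h.evalFrom_eq_of_start hv', h.sink]

/-- Every set of states containing `z` but not the initial state is the set of states that some word
takes to `z`. -/
theorem exists_word_preimage (h : IsRich M z) (Z : Set Q) (hz : z ∈ Z) (hs : M.start ∉ Z) :
    ∃ w, ∀ q, M.evalFrom q w = z ↔ q ∈ Z := by
  classical
  -- Collapse `Z` to `z` and fix everything else.
  obtain ⟨w, hw⟩ := h.full (fun q => if q ∈ Z then z else q) (by simp [hs]) (by simp)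
  refine ⟨w, fun q => ?_⟩
  rw [hw]
  by_cases hq : q ∈ Z
  · simp [hq]
  · simp only [hq, if_false, iff_false]
    rintro rfl
    exact hq hz

theorem acceptsFrom_injective (h : IsRich M z) : Function.Injective M.acceptsFrom := by
  have key : ∀ p q : Q, p ≠ q → p ≠ M.start → q ≠ z → M.acceptsFrom p ≠ M.acceptsFrom q := by
    intro p q hpq hp hq heq
    obtain ⟨w, hw⟩ := h.exists_word_preimage {p, z} (by simp) (by simp [hp.symm, h.start_ne])
    have h1 : w ∈ M.acceptsFrom p := h.mem_acceptsFrom.2 ((hw p).2 (by simp))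
    rw [heq, h.mem_acceptsFrom, hw] at h1
    simp [hpq.symm, hq] at h1
  intro p q heq
  by_contra hpq
  by_cases hp : p = M.start
  · exact key q p (Ne.symm hpq) (by rintro rfl; exact hpq hp) (hp ▸ h.start_ne) heq.symm
  · by_cases hq : q = z
    · exact key q p (Ne.symm hpq) (hq ▸ h.start_ne.symm) (by rintro rfl; exact hpq hq.symm) heq.symm
    · exact key p q hpq hp hq heq

theorem range_acceptsFrom (h : IsRich M z) : Set.range M.acceptsFrom = quotients M.accepts := by
  apply Set.Subset.antisymm
  · rintro _ ⟨j, rfl⟩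
    obtain ⟨w, hw⟩ := h.collapse j
    refine ⟨w, ?_⟩
    rw [Language.leftQuotient_accepts_apply, DFA.eval, hw _ h.start_ne]
  · rintro _ ⟨w, rfl⟩
    exact ⟨M.eval w, (Language.leftQuotient_accepts_apply M w).symm⟩

theorem complexity_accepts (h : IsRich M z) : complexity M.accepts = (Fintype.card Q : ℕ∞) := by
  rw [complexity, ← h.range_acceptsFrom, ← Set.image_univ, h.acceptsFrom_injective.encard_image,
    Set.encard_univ, ENat.card_eq_coe_fintype_card]

theorem mem_atomicIntersection (h : IsRich M z) {S : Set Q} {w : List α} :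
    w ∈ atomicIntersection M.acceptsFrom S ↔ ∀ q, M.evalFrom q w = z ↔ q ∈ S := by
  change ((∀ i ∈ S, w ∈ M.acceptsFrom i) ∧ ∀ i ∉ S, w ∉ M.acceptsFrom i) ↔ _
  simp only [h.mem_acceptsFrom]
  constructor
  · rintro ⟨h1, h2⟩ q
    exact ⟨fun hq => by_contra fun hn => h2 q hn hq, h1 q⟩
  · intro h1
    exact ⟨fun q hq => (h1 q).2 hq, fun q hq hn => hq ((h1 q).1 hn)⟩

theorem nonempty_atomicIntersection_iff (h : IsRich M z) {S : Set Q} :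
    (∃ w, w ∈ atomicIntersection M.acceptsFrom S) ↔
      S = Set.univ ∨ (z ∈ S ∧ M.start ∉ S) := by
  simp only [h.mem_atomicIntersection]
  constructor
  · rintro ⟨w, hw⟩
    by_cases hs : M.start ∈ S
    · left
      ext q
      simpa using (hw q).1 (h.evalFrom_eq_of_start ((hw _).2 hs) q)
    · exact Or.inr ⟨(hw z).1 (h.sink w), hs⟩
  · rintro (rfl | ⟨hz, hs⟩)
    · obtain ⟨w, hw⟩ := h.collapse z
      exact ⟨w, fun q => by simpa using h.evalFrom_eq_of_start (hw _ h.start_ne) q⟩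
    · exact h.exists_word_preimage S hz hs

/-- Passes from sets of quotients to sets of states, through the bijection `q ↦ M.acceptsFrom q`
onto the quotients. -/
theorem isAtomOf_iff (h : IsRich M z) {A : Language α} :
    IsAtomOf M.accepts A ↔ ∃ S : Set Q, (S = Set.univ ∨ (z ∈ S ∧ M.start ∉ S)) ∧
      A = atomicIntersection M.acceptsFrom S := by
  have hmem : ∀ q, M.acceptsFrom q ∈ quotients M.accepts := fun q =>
    h.range_acceptsFrom ▸ Set.mem_range_self q
  constructor
  · rintro ⟨hne, T, rfl⟩
    have : atomicIntersection (fun K : quotients M.accepts => (K : Language α)) T =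
        atomicIntersection M.acceptsFrom {q | (⟨M.acceptsFrom q, hmem q⟩ : quotients _) ∈ T} := by
      have hsurj : ∀ K : quotients M.accepts, ∃ q, K = ⟨M.acceptsFrom q, hmem q⟩ := by
        rintro ⟨K, hK⟩
        rw [← h.range_acceptsFrom] at hK
        obtain ⟨q, rfl⟩ := hK
        exact ⟨q, rfl⟩
      ext w
      constructor
      · rintro ⟨h1, h2⟩
        exact ⟨fun q hq => h1 _ hq, fun q hq => h2 _ hq⟩
      · rintro ⟨h1, h2⟩
        constructor
        · intro K hK
          obtain ⟨q, rfl⟩ := hsurj K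
          exact h1 q hK
        · intro K hK
          obtain ⟨q, rfl⟩ := hsurj K
          exact h2 q hK
    rw [this] at hne ⊢
    exact ⟨_, h.nonempty_atomicIntersection_iff.1 hne, rfl⟩
  · rintro ⟨S, hS, rfl⟩
    refine ⟨h.nonempty_atomicIntersection_iff.2 hS, {K | ∃ q ∈ S, M.acceptsFrom q = K}, ?_⟩
    ext w
    constructor
    · rintro ⟨h1, h2⟩
      constructor
      · rintro K ⟨q, hq, hK⟩
        change w ∈ (K : Language α)
        exact hK ▸ h1 q hq
      · rintro ⟨K, hK'⟩ hK
        rw [← h.range_acceptsFrom] at hK'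
        obtain ⟨q, rfl⟩ := hK'
        exact h2 q fun hq => hK ⟨q, hq, rfl⟩
    · rintro ⟨h1, h2⟩
      constructor
      · intro q hq
        exact h1 ⟨_, hmem q⟩ ⟨q, hq, rfl⟩
      · intro q hq
        refine h2 ⟨_, hmem q⟩ ?_
        rintro ⟨p, hp, hpq⟩
        exact hq (h.acceptsFrom_injective hpq ▸ hp)

theorem insert_injOn_powerset_middle :
    Set.InjOn (fun X : Finset Q => insert z X) ((middle M z).powerset : Set (Finset Q)) := by
  intro X hX Y hY hXY
  have hz : ∀ X ∈ (middle M z).powerset, z ∉ X := fun X hX hzX =>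
    (mem_middle.1 (Finset.mem_powerset.1 hX hzX)).2 rfl
  have := congrArg (fun T => T.erase z) hXY
  simpa [Finset.erase_insert (hz X hX), Finset.erase_insert (hz Y hY)] using this

theorem encard_atoms (h : IsRich M z) :
    {A | IsAtomOf M.accepts A}.encard = ((2 ^ (Fintype.card Q - 2) + 1 : ℕ) : ℕ∞) := by
  have hset : {A | IsAtomOf M.accepts A} = atomicIntersection M.acceptsFrom ''
      insert Set.univ ((fun X : Finset Q => ((insert z X : Finset Q) : Set Q)) ''
        ((middle M z).powerset : Set (Finset Q))) := by
    ext A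
    rw [Set.mem_ofPred_eq, h.isAtomOf_iff]
    constructor
    · rintro ⟨S, rfl | ⟨hz, hs⟩, rfl⟩
      · exact ⟨_, Set.mem_insert _ _, rfl⟩
      · classical
        refine ⟨S, Set.mem_insert_of_mem _ ⟨S.toFinset.erase z, ?_, ?_⟩, rfl⟩
        · simp only [Finset.coe_powerset, Set.mem_preimage, Set.mem_powerset_iff]
          intro q hq
          have hq' : q ≠ z ∧ q ∈ S := by simpa [and_comm] using hq
          exact mem_middle.2 ⟨fun e => hs (e ▸ hq'.2), hq'.1⟩
        · change ((insert z (S.toFinset.erase z) : Finset Q) : Set Q) = S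
          rw [Finset.insert_erase (Set.mem_toFinset.2 hz), Set.coe_toFinset]
    · rintro ⟨S, rfl | ⟨X, hX, rfl⟩, rfl⟩
      · exact ⟨_, Or.inl rfl, rfl⟩
      · refine ⟨_, Or.inr ⟨by simp, ?_⟩, rfl⟩
        simp only [Finset.coe_insert, Set.mem_insert_iff, h.start_ne, false_or]
        exact fun hs => (mem_middle.1 (Finset.mem_powerset.1 hX hs)).1 rfl
  have hinj : Set.InjOn (atomicIntersection M.acceptsFrom)
      {S | S = Set.univ ∨ (z ∈ S ∧ M.start ∉ S)} := by
    -- A word determines its preimage of `z`, so any common word forces the two index sets to agree.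
    intro S hS T _ hST
    obtain ⟨w, hw⟩ := h.nonempty_atomicIntersection_iff.2 hS
    have hw' := hw
    rw [hST, h.mem_atomicIntersection] at hw'
    rw [h.mem_atomicIntersection] at hw
    ext q
    rw [← hw, ← hw']
  have hstart : ∀ X ∈ ((middle M z).powerset : Set (Finset Q)),
      M.start ∉ ((insert z X : Finset Q) : Set Q) := by
    intro X hX
    simp only [Finset.coe_insert, Set.mem_insert_iff, h.start_ne, false_or]
    exact fun hs => (mem_middle.1 (Finset.mem_powerset.1 hX hs)).1 rfl
  rw [hset, Set.InjOn.encard_image (hinj.mono ?_), Set.encard_insert_of_notMem,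
    Set.InjOn.encard_image, Set.encard_coe_eq_coe_finsetCard, Finset.card_powerset, h.card_middle]
  · norm_cast
  · intro X hX Y hY hXY
    exact insert_injOn_powerset_middle hX hY (Finset.coe_injective hXY)
  · rintro ⟨X, hX, hu⟩
    exact hstart X hX (by simp only [hu, Set.mem_univ])
  · rintro S (rfl | ⟨X, hX, rfl⟩)
    · exact Or.inl rfl
    · exact Or.inr ⟨by simp, hstart X hX⟩

/-! ### Quotients of atoms -/

theorem mem_pairLang (h : IsRich M z) {X Y : Finset Q} {v : List α} :
    v ∈ pairLang M X Y ↔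
      (∀ q ∈ X, M.evalFrom q v = z) ∧ ∀ q ∈ Y, M.evalFrom q v ≠ z := by
  change ((∀ q ∈ X, v ∈ M.acceptsFrom q) ∧ ∀ q ∈ Y, v ∉ M.acceptsFrom q) ↔ _
  simp only [h.mem_acceptsFrom, ne_eq]

theorem leftQuotient_atomicIntersection (h : IsRich M z) (S : Finset Q) (w : List α) :
    (atomicIntersection M.acceptsFrom (S : Set Q)).leftQuotient w =
      pairLang M (S.image (M.evalFrom · w)) (Sᶜ.image (M.evalFrom · w)) := by
  ext v
  rw [Language.mem_leftQuotient, h.mem_atomicIntersection, h.mem_pairLang]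
  simp only [Finset.forall_mem_image, ← M.evalFrom_of_append, Finset.mem_compl, Finset.mem_coe]
  constructor
  · intro h1
    exact ⟨fun q hq => (h1 q).2 hq, fun q hq hn => hq ((h1 q).1 hn)⟩
  · rintro ⟨h1, h2⟩ q
    exact ⟨fun hq => by_contra fun hn => h2 hn hq, fun hq => h1 hq⟩

/-- The pairs of disjoint sets of states, the first containing `z`, the second containing the
initial state. -/
def NormalPair (M : DFA α Q) (z : Q) (p : Finset Q × Finset Q) : Prop :=
  z ∈ p.1 ∧ M.start ∈ p.2 ∧ Disjoint p.1 p.2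

theorem exists_mem_pairLang_preimage (h : IsRich M z) {p : Finset Q × Finset Q}
    (hp : NormalPair M z p) (Z : Finset Q) (h1 : p.1 ⊆ Z) (h2 : Disjoint Z p.2) :
    ∃ v ∈ pairLang M p.1 p.2, ∀ q, M.evalFrom q v = z ↔ q ∈ Z := by
  obtain ⟨v, hv⟩ := h.exists_word_preimage Z (h1 hp.1)
    (fun hs => Finset.disjoint_left.1 h2 hs hp.2.1)
  refine ⟨v, h.mem_pairLang.2 ⟨fun q hq => (hv q).2 (h1 hq), fun q hq hn => ?_⟩, hv⟩
  exact Finset.disjoint_left.1 h2 ((hv q).1 hn) hq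

theorem pairLang_ne_bot (h : IsRich M z) {p : Finset Q × Finset Q} (hp : NormalPair M z p) :
    pairLang M p.1 p.2 ≠ ⊥ := by
  obtain ⟨v, hv, -⟩ := h.exists_mem_pairLang_preimage hp p.1 subset_rfl hp.2.2
  intro hb
  rw [hb] at hv
  exact hv

/-- The preimages of `z` under words of the language are exactly the sets between `p.1` and `p.2ᶜ`
that words can have as preimages; testing both extremes recovers the pair. -/
theorem pair_le_of_pairLang_eq (h : IsRich M z) {p r : Finset Q × Finset Q}
    (hp : NormalPair M z p) (heq : pairLang M p.1 p.2 = pairLang M r.1 r.2) :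
    r.1 ⊆ p.1 ∧ r.2 ⊆ p.2 := by
  constructor
  · obtain ⟨v, hv, hZ⟩ := h.exists_mem_pairLang_preimage hp p.1 subset_rfl hp.2.2
    rw [heq, h.mem_pairLang] at hv
    exact fun q hq => (hZ q).1 (hv.1 q hq)
  · obtain ⟨v, hv, hZ⟩ := h.exists_mem_pairLang_preimage hp p.2ᶜ
      (fun q hq => Finset.mem_compl.2 (Finset.disjoint_left.1 hp.2.2 hq)) disjoint_compl_left
    rw [heq, h.mem_pairLang] at hv
    intro q hq
    by_contra hn
    exact hv.2 q hq ((hZ q).2 (Finset.mem_compl.2 hn))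

theorem pairLang_injOn (h : IsRich M z) :
    Set.InjOn (fun p : Finset Q × Finset Q => pairLang M p.1 p.2) {p | NormalPair M z p} := by
  intro p hp r hr heq
  have h1 := h.pair_le_of_pairLang_eq hp heq
  have h2 := h.pair_le_of_pairLang_eq hr heq.symm
  exact Prod.ext (h2.1.antisymm h1.1) (h2.2.antisymm h1.2)

theorem pairLang_eq_bot_of_mem {X Y : Finset Q} {q : Q} (hX : q ∈ X) (hY : q ∈ Y) :
    pairLang M X Y = ⊥ := by
  refine le_bot_iff.1 fun v hv => ?_
  exact hv.2 q hY (hv.1 q hX)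

theorem pairLang_insert_start (h : IsRich M z) {X : Finset Q} {j : Q} :
    pairLang M X {M.start, j} = pairLang M X {j} := by
  ext v
  simp only [h.mem_pairLang, Finset.mem_insert, Finset.mem_singleton, forall_eq_or_imp, forall_eq,
    and_congr_right_iff, and_iff_right_iff_imp]
  exact fun _ hj hs => hj (h.evalFrom_eq_of_start hs j)

/-- A nonempty quotient of an atom that is not the smallest one is given either by the images under
a word fixing the initial state, or by `z` and one other state. -/
theorem leftQuotient_cases (h : IsRich M z) {S : Finset Q} (hz : z ∈ S) (hs : M.start ∉ S)
    (w : List α) :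
    let B := (atomicIntersection M.acceptsFrom (S : Set Q)).leftQuotient w
    B = ⊥ ∨
    (∃ p : Finset Q × Finset Q, NormalPair M z p ∧ p.1.card ≤ S.card ∧ p.2.card ≤ Sᶜ.card ∧
      pairLang M p.1 p.2 = B) ∨
    ∃ j, j ≠ z ∧ j ≠ M.start ∧ pairLang M {z} {M.start, j} = B := by
  intro B
  have hB : B = _ := h.leftQuotient_atomicIntersection S w
  set X := S.image (M.evalFrom · w) with hX
  set Y := Sᶜ.image (M.evalFrom · w) with hY
  by_cases hd : Disjoint X Y
  swap
  · obtain ⟨q, h1, h2⟩ := Finset.not_disjoint_iff.1 hd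
    exact Or.inl (hB.trans (pairLang_eq_bot_of_mem h1 h2))
  have hzX : z ∈ X := Finset.mem_image.2 ⟨z, hz, h.sink w⟩
  have hsY : M.evalFrom M.start w ∈ Y := Finset.mem_image_of_mem _ (Finset.mem_compl.2 hs)
  right
  by_cases hfix : M.evalFrom M.start w = M.start
  · left
    exact ⟨(X, Y), ⟨hzX, hfix ▸ hsY, hd⟩, Finset.card_image_le, Finset.card_image_le, hB.symm⟩
  right
  have hdich := (h.dichotomy w).resolve_left hfix
  have hzY : z ∉ Y := Finset.disjoint_left.1 hd hzX
  -- Once `w` moves the start, all images lie in `{M.evalFrom M.start w, z}`; disjointness then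
  -- makes `X` and `Y` singletons.
  refine ⟨M.evalFrom M.start w, fun e => hzY (e ▸ hsY), hfix, ?_⟩
  rw [h.pairLang_insert_start, hB]
  congr 1
  · ext q
    rw [Finset.mem_singleton]
    constructor
    · rintro rfl
      exact hzX
    · intro hq
      obtain ⟨r, -, rfl⟩ := Finset.mem_image.1 hq
      exact (hdich r).resolve_left fun e => Finset.disjoint_left.1 hd hq (e ▸ hsY)
  · ext q
    rw [Finset.mem_singleton]
    constructor
    · rintro rfl
      exact hsY
    · intro hq
      obtain ⟨r, -, rfl⟩ := Finset.mem_image.1 hq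
      exact (hdich r).resolve_right fun e => hzY (e ▸ hq)

theorem bot_mem_quotients (h : IsRich M z) {S : Finset Q} (hz : z ∈ S) (hs : M.start ∉ S) :
    ⊥ ∈ quotients (atomicIntersection M.acceptsFrom (S : Set Q)) := by
  obtain ⟨w, hw⟩ := h.collapse z
  refine ⟨w, ?_⟩
  rw [h.leftQuotient_atomicIntersection]
  exact pairLang_eq_bot_of_mem (q := z) (Finset.mem_image.2 ⟨z, hz, h.sink w⟩)
    (Finset.mem_image.2 ⟨M.start, Finset.mem_compl.2 hs, hw _ h.start_ne⟩)

/-- A language whose quotients are the empty one and those given by a set of normal pairs. -/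
theorem complexity_eq_card_add_one (h : IsRich M z) {A : Language α}
    (F : Finset (Finset Q × Finset Q)) (hF : ∀ p ∈ F, NormalPair M z p)
    (hbot : ⊥ ∈ quotients A) (hle : ∀ p ∈ F, pairLang M p.1 p.2 ∈ quotients A)
    (hge : ∀ w, A.leftQuotient w = ⊥ ∨ ∃ p ∈ F, pairLang M p.1 p.2 = A.leftQuotient w) :
    complexity A = ((F.card + 1 : ℕ) : ℕ∞) := by
  have : quotients A = insert ⊥ ((fun p : Finset Q × Finset Q => pairLang M p.1 p.2) '' F) := by
    ext B
    constructor
    · rintro ⟨w, rfl⟩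
      exact hge w
    · rintro (rfl | ⟨p, hp, rfl⟩)
      · exact hbot
      · exact hle p hp
  rw [complexity, this, Set.encard_insert_of_notMem, Set.InjOn.encard_image,
    Set.encard_coe_eq_coe_finsetCard]
  · norm_cast
  · exact h.pairLang_injOn.mono hF
  · rintro ⟨p, hp, hb⟩
    exact h.pairLang_ne_bot (hF p hp) hb

/-- The map is a left inverse of an embedding of `B.erase b` into `A.erase a`, with default value
`b` off its range. -/
theorem exists_map_image_eq {A B : Finset Q} {a b : Q} (ha : a ∈ A) (hb : b ∈ B)
    (hcard : B.card ≤ A.card) : ∃ f : Q → Q, f a = b ∧ A.image f = B := by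
  have hle : Fintype.card (B.erase b) ≤ Fintype.card (A.erase a) := by
    simp only [Fintype.card_coe, Finset.card_erase_of_mem ha, Finset.card_erase_of_mem hb]
    omega
  obtain ⟨g⟩ := Function.Embedding.nonempty_of_card_le hle
  classical
  let f : Q → Q := fun x => if hx : ∃ y, (g y : Q) = x then (hx.choose : Q) else b
  have hf : ∀ y, f (g y) = y := fun y => by
    have hx : ∃ y', (g y' : Q) = g y := ⟨y, rfl⟩
    have : hx.choose = y := g.injective (Subtype.ext hx.choose_spec)
    simp only [f, dif_pos hx, this]
  have hfa : f a = b := by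
    refine dif_neg ?_
    rintro ⟨y, hy⟩
    exact (Finset.mem_erase.1 (g y).2).1 hy
  refine ⟨f, hfa, ?_⟩
  ext x
  rw [Finset.mem_image]
  constructor
  · rintro ⟨y, -, rfl⟩
    by_cases hx : ∃ y', (g y' : Q) = y
    · simp only [f, dif_pos hx]
      exact Finset.mem_of_mem_erase hx.choose.2
    · simp only [f, dif_neg hx, hb]
  · intro hx
    by_cases hxb : x = b
    · exact ⟨a, ha, hfa.trans hxb.symm⟩
    · let y : B.erase b := ⟨x, Finset.mem_erase.2 ⟨hxb, hx⟩⟩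
      exact ⟨g y, Finset.mem_of_mem_erase (g y).2, hf y⟩

/-- Surjections from `S` and `Sᶜ` onto the two sets, fixing `z` and the start respectively, glue to
a transformation realized by `full`. -/
theorem pairLang_mem_quotients (h : IsRich M z) {S : Finset Q} (hz : z ∈ S) (hs : M.start ∉ S)
    {p : Finset Q × Finset Q} (hp : NormalPair M z p) (h1 : p.1.card ≤ S.card)
    (h2 : p.2.card ≤ Sᶜ.card) :
    pairLang M p.1 p.2 ∈ quotients (atomicIntersection M.acceptsFrom (S : Set Q)) := by
  obtain ⟨f, hf, hfi⟩ := exists_map_image_eq hz hp.1 h1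
  obtain ⟨g, hg, hgi⟩ := exists_map_image_eq (Finset.mem_compl.2 hs) hp.2.1 h2
  obtain ⟨w, hw⟩ := h.full (fun q => if q ∈ S then f q else g q) (by simp [hs, hg])
    (by simp [hz, hf])
  refine ⟨w, ?_⟩
  rw [h.leftQuotient_atomicIntersection]
  congr 1
  · rw [← hfi]
    exact Finset.image_congr fun q hq => by simp [hw, Finset.mem_coe.1 hq]
  · rw [← hgi]
    refine Finset.image_congr fun q hq => ?_
    have hq' : q ∉ S := Finset.mem_compl.1 hq
    simp [hw, hq']

/-- This atom is the language itself, the quotient accepted from the start being contained in all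
the others. -/
theorem complexity_univ (h : IsRich M z) :
    complexity (atomicIntersection M.acceptsFrom ((Finset.univ : Finset Q) : Set Q)) =
      (Fintype.card Q : ℕ∞) := by
  rw [← h.complexity_accepts]
  congr 1
  ext w
  rw [h.mem_atomicIntersection]
  simp only [Finset.coe_univ, Set.mem_univ, iff_true]
  exact ⟨fun h1 => h.mem_acceptsFrom.2 (h1 _),
    fun h1 => h.evalFrom_eq_of_start (h.mem_acceptsFrom.1 h1)⟩

theorem complexity_univ_sdiff_start (h : IsRich M z) :
    complexity (atomicIntersection M.acceptsFrom
      ((Finset.univ \ {M.start} : Finset Q) : Set Q)) =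
      ((2 ^ (Fintype.card Q - 2) + (Fintype.card Q - 2) + 1 : ℕ) : ℕ∞) := by
  have hz : z ∈ (Finset.univ \ {M.start} : Finset Q) := by simp [h.start_ne.symm]
  have hs : M.start ∉ (Finset.univ \ {M.start} : Finset Q) := by simp
  have hcompl : (Finset.univ \ {M.start} : Finset Q)ᶜ = {M.start} := by
    ext q
    simp
  -- `F₁` collects the pairs given by words fixing the start, `F₂` the collapsed pairs, whose second
  -- set is too large for `F₁`. The empty quotient supplies the final `+ 1`.
  let F₁ : Finset (Finset Q × Finset Q) :=
    (middle M z).powerset.image fun X => (insert z X, {M.start})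
  let F₂ : Finset (Finset Q × Finset Q) := (middle M z).image fun j => ({z}, {M.start, j})
  have hn₁ : ∀ p ∈ F₁, NormalPair M z p := by
    intro p hp
    obtain ⟨X, hX, rfl⟩ := Finset.mem_image.1 hp
    refine ⟨by simp, by simp, ?_⟩
    simp only [Finset.disjoint_singleton_right, Finset.mem_insert, h.start_ne, false_or]
    exact fun hq => (mem_middle.1 (Finset.mem_powerset.1 hX hq)).1 rfl
  have hn₂ : ∀ p ∈ F₂, NormalPair M z p := by
    intro p hp
    obtain ⟨j, hj, rfl⟩ := Finset.mem_image.1 hp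
    refine ⟨by simp, by simp, ?_⟩
    simp only [Finset.disjoint_singleton_left, Finset.mem_insert, Finset.mem_singleton, not_or]
    exact ⟨h.start_ne.symm, (mem_middle.1 hj).2.symm⟩
  have hcard : (F₁ ∪ F₂).card = 2 ^ (Fintype.card Q - 2) + (Fintype.card Q - 2) := by
    rw [Finset.card_union_of_disjoint, Finset.card_image_of_injOn, Finset.card_image_of_injOn,
      Finset.card_powerset, h.card_middle]
    · intro i hi j hj hij
      have h1 : ({M.start, i} : Finset Q) = {M.start, j} := congrArg Prod.snd hij
      have h2 : i ∈ ({M.start, j} : Finset Q) := h1 ▸ by simp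
      simpa [(mem_middle.1 hi).1] using h2
    · intro X hX Y hY hXY
      exact insert_injOn_powerset_middle hX hY (congrArg Prod.fst hXY)
    · rw [Finset.disjoint_left]
      intro p h1 h2
      obtain ⟨X, -, rfl⟩ := Finset.mem_image.1 h1
      obtain ⟨j, hj, hij⟩ := Finset.mem_image.1 h2
      have h3 : ({M.start, j} : Finset Q) = {M.start} := congrArg Prod.snd hij
      have h4 : j ∈ ({M.start} : Finset Q) := h3 ▸ by simp
      exact (mem_middle.1 hj).1 (Finset.mem_singleton.1 h4)
  have hmem₁ : ∀ p, NormalPair M z p → p.2.card ≤ 1 → p ∈ F₁ := by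
    rintro ⟨X, Y⟩ ⟨h1, h2, h3⟩ h4
    dsimp only at h1 h2 h3 h4
    have hY : Y = {M.start} :=
      (Finset.eq_of_subset_of_card_le (Finset.singleton_subset_iff.2 h2) (by simpa using h4)).symm
    subst hY
    refine Finset.mem_image.2 ⟨X.erase z, Finset.mem_powerset.2 fun q hq => ?_, ?_⟩
    · rw [Finset.mem_erase] at hq
      refine mem_middle.2 ⟨?_, hq.1⟩
      rintro rfl
      exact Finset.disjoint_left.1 h3 hq.2 (by simp)
    · rw [Finset.insert_erase h1]
  have hlow : ∀ p ∈ F₁, p.1.card ≤ (Finset.univ \ {M.start} : Finset Q).card ∧ p.2.card ≤ 1 := by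
    intro p hp
    have hp' := hn₁ p hp
    obtain ⟨X, hX, rfl⟩ := Finset.mem_image.1 hp
    refine ⟨Finset.card_le_card fun q hq => ?_, by simp⟩
    rw [Finset.mem_sdiff]
    exact ⟨Finset.mem_univ _, Finset.disjoint_left.1 hp'.2.2 hq⟩
  rw [← hcard]
  refine h.complexity_eq_card_add_one (F₁ ∪ F₂) ?_ (h.bot_mem_quotients hz hs) ?_ ?_
  · intro p hp
    exact (Finset.mem_union.1 hp).elim (hn₁ p) (hn₂ p)
  · intro p hp
    rcases Finset.mem_union.1 hp with hp | hp
    · exact h.pairLang_mem_quotients hz hs (hn₁ p hp) (hlow p hp).1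
        (by rw [hcompl, Finset.card_singleton]; exact (hlow p hp).2)
    · obtain ⟨j, hj, rfl⟩ := Finset.mem_image.1 hp
      -- First `u` sends all states but the start to `z`; then `v` takes the one remaining image to
      -- `j`.
      obtain ⟨u, hu⟩ := h.exists_word_preimage {q | q ≠ M.start} h.start_ne.symm (by simp)
      obtain ⟨v, hv⟩ := h.collapse j
      refine ⟨u ++ v, ?_⟩
      rw [h.leftQuotient_atomicIntersection, h.pairLang_insert_start, hcompl,
        Finset.image_singleton, M.evalFrom_of_append, hv _ fun e => (hu _).1 e rfl]
      congr 1
      ext q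
      rw [Finset.mem_image, Finset.mem_singleton]
      constructor
      · rintro ⟨r, hr, rfl⟩
        have hr' : r ≠ M.start := by simpa using hr
        simp only [M.evalFrom_of_append, (hu r).2 hr', h.sink]
      · rintro rfl
        exact ⟨q, hz, h.sink _⟩
  · intro w
    rcases h.leftQuotient_cases hz hs w with hw | ⟨p, hp, -, h2, hw⟩ | ⟨j, hjz, hjs, hw⟩
    · exact Or.inl hw
    · rw [hcompl, Finset.card_singleton] at h2
      exact Or.inr ⟨p, Finset.mem_union_left _ (hmem₁ p hp h2), hw⟩
    · exact Or.inr ⟨_, Finset.mem_union_right _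
        (Finset.mem_image.2 ⟨j, mem_middle.2 ⟨hjs, hjz⟩, rfl⟩), hw⟩

open Classical in
/-- The number of normal pairs with sets of at most `s` and at most `m` elements. -/
theorem card_normalPairs (h : IsRich M z) (s m : ℕ) :
    ({p : Finset Q × Finset Q | NormalPair M z p ∧ p.1.card ≤ s ∧ p.2.card ≤ m} :
      Finset (Finset Q × Finset Q)).card =
      ∑ x ∈ Finset.Icc 1 s, ∑ y ∈ Finset.Icc 1 m,
        (Fintype.card Q - 2).choose (x - 1) * (Fintype.card Q - x - 1).choose (y - 1) := by
  -- Sort by the two sizes and remove the forced elements `z` and `M.start`, which shifts each size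
  -- by one; `Y` is then chosen in what `X` leaves of the middle.
  let T : Finset (Σ _ : ℕ, Σ _ : ℕ, Σ _ : Finset Q, Finset Q) :=
    (Finset.Icc 1 s).sigma fun x => (Finset.Icc 1 m).sigma fun y =>
      ((middle M z).powersetCard (x - 1)).sigma fun X => (middle M z \ X).powersetCard (y - 1)
  have hT : T.card = ∑ x ∈ Finset.Icc 1 s, ∑ y ∈ Finset.Icc 1 m,
        (Fintype.card Q - 2).choose (x - 1) * (Fintype.card Q - x - 1).choose (y - 1) := by
    simp only [T, Finset.card_sigma]
    refine Finset.sum_congr rfl fun x hx => Finset.sum_congr rfl fun y _ => ?_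
    rw [Finset.sum_congr rfl (g := fun _ => (Fintype.card Q - x - 1).choose (y - 1)),
      Finset.sum_const, Finset.card_powersetCard, h.card_middle, smul_eq_mul]
    intro X hX
    rw [Finset.mem_powersetCard] at hX
    rw [Finset.card_powersetCard, Finset.card_sdiff_of_subset hX.1, hX.2, h.card_middle]
    have := (Finset.mem_Icc.1 hx).1
    congr 1
    omega
  rw [← hT]
  have hTmem : ∀ x y X Y, (⟨x, y, X, Y⟩ : Σ _ : ℕ, Σ _ : ℕ, Σ _ : Finset Q, Finset Q) ∈ T ↔
      (1 ≤ x ∧ x ≤ s) ∧ (1 ≤ y ∧ y ≤ m) ∧ (X ⊆ middle M z ∧ X.card = x - 1) ∧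
        (Y ⊆ middle M z \ X ∧ Y.card = y - 1) := by
    intro x y X Y
    simp only [T, Finset.mem_sigma, Finset.mem_Icc, Finset.mem_powersetCard]
  have hzm : ∀ X ⊆ middle M z, z ∉ X := fun X hX hq => (mem_middle.1 (hX hq)).2 rfl
  have hsm : ∀ X ⊆ middle M z, M.start ∉ X := fun X hX hq => (mem_middle.1 (hX hq)).1 rfl
  symm
  refine Finset.card_nbij' (fun t => (insert z t.2.2.1, insert M.start t.2.2.2))
    (fun p => ⟨p.1.card, p.2.card, p.1.erase z, p.2.erase M.start⟩) ?_ ?_ ?_ ?_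
  · rintro ⟨x, y, X, Y⟩ ht
    obtain ⟨hx, hy, hX, hY⟩ := (hTmem _ _ _ _).1 ht
    have hY' := hY.1.trans Finset.sdiff_subset
    refine Finset.mem_coe.2 (Finset.mem_filter.2 ⟨Finset.mem_univ _,
      ⟨Finset.mem_insert_self _ _, Finset.mem_insert_self _ _, ?_⟩, ?_, ?_⟩)
    rotate_left
    · rw [Finset.card_insert_of_notMem (hzm X hX.1)]
      omega
    · rw [Finset.card_insert_of_notMem (hsm Y hY')]
      omega
    dsimp only
    rw [Finset.disjoint_insert_left, Finset.disjoint_insert_right, Finset.mem_insert, not_or]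
    refine ⟨⟨h.start_ne.symm, hzm Y hY'⟩, hsm X hX.1, ?_⟩
    exact Finset.disjoint_right.2 fun q hq => (Finset.mem_sdiff.1 (hY.1 hq)).2
  · rintro ⟨X, Y⟩ hp
    obtain ⟨⟨hz, hs, hd⟩, hX, hY⟩ := (Finset.mem_filter.1 (Finset.mem_coe.1 hp)).2
    have h1 := Finset.card_pos.2 ⟨z, hz⟩
    have h2 := Finset.card_pos.2 ⟨M.start, hs⟩
    refine (hTmem _ _ _ _).2 ⟨⟨h1, hX⟩, ⟨h2, hY⟩, ⟨fun q hq => ?_, Finset.card_erase_of_mem hz⟩,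
      fun q hq => ?_, Finset.card_erase_of_mem hs⟩
    · rw [Finset.mem_erase] at hq
      refine mem_middle.2 ⟨?_, hq.1⟩
      rintro rfl
      exact Finset.disjoint_left.1 hd hq.2 hs
    · rw [Finset.mem_erase] at hq
      have hqX : q ∉ X := Finset.disjoint_right.1 hd hq.2
      refine Finset.mem_sdiff.2 ⟨mem_middle.2 ⟨hq.1, ?_⟩, fun h3 => hqX (Finset.mem_of_mem_erase h3)⟩
      rintro rfl
      exact hqX hz
  · rintro ⟨x, y, X, Y⟩ ht
    obtain ⟨hx, hy, hX, hY⟩ := (hTmem _ _ _ _).1 ht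
    have hY' := hY.1.trans Finset.sdiff_subset
    have e1 : X.card + 1 = x := by omega
    have e2 : Y.card + 1 = y := by omega
    simp only [Finset.card_insert_of_notMem (hzm X hX.1), Finset.card_insert_of_notMem (hsm Y hY'),
      Finset.erase_insert (hzm X hX.1), Finset.erase_insert (hsm Y hY'), e1, e2]
  · rintro ⟨X, Y⟩ hp
    obtain ⟨⟨hz, hs, -⟩, -⟩ := (Finset.mem_filter.1 (Finset.mem_coe.1 hp)).2
    exact Prod.ext (Finset.insert_erase hz) (Finset.insert_erase hs)

/-- With two elements in `Sᶜ`, the collapsed pair `({z}, {M.start, j})` already satisfies the size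
bounds and adds nothing to the count. -/
theorem complexity_of_two_le_card_compl (h : IsRich M z) {S : Finset Q} (hz : z ∈ S)
    (hs : M.start ∉ S) (hcard : 2 ≤ Sᶜ.card) :
    complexity (atomicIntersection M.acceptsFrom (S : Set Q)) =
      ((1 + ∑ x ∈ Finset.Icc 1 S.card, ∑ y ∈ Finset.Icc 1 (Fintype.card Q - S.card),
        (Fintype.card Q - 2).choose (x - 1) * (Fintype.card Q - x - 1).choose (y - 1) : ℕ) :
        ℕ∞) := by
  classical
  rw [← h.card_normalPairs, add_comm 1, ← Finset.card_compl]
  refine h.complexity_eq_card_add_one _ ?_ (h.bot_mem_quotients hz hs) ?_ ?_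
  · intro p hp
    exact (Finset.mem_filter.1 hp).2.1
  · intro p hp
    obtain ⟨h1, h2, h3⟩ := (Finset.mem_filter.1 hp).2
    exact h.pairLang_mem_quotients hz hs h1 h2 h3
  · intro w
    rcases h.leftQuotient_cases hz hs w with hw | ⟨p, hp, h1, h2, hw⟩ | ⟨j, hjz, hjs, hw⟩
    · exact Or.inl hw
    · exact Or.inr ⟨p, Finset.mem_filter.2 ⟨Finset.mem_univ _, hp, h1, h2⟩, hw⟩
    · refine Or.inr ⟨({z}, {M.start, j}), Finset.mem_filter.2
        ⟨Finset.mem_univ _, ⟨by simp, by simp, ?_⟩, ?_, ?_⟩, hw⟩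
      · simp [h.start_ne.symm, hjz.symm]
      · simpa using Finset.card_pos.2 ⟨z, hz⟩
      · exact Finset.card_le_two.trans hcard

end IsRich

end Abstract

/-! ### Transformations realized by words, and invariants checked on letters. -/

section Generation

variable {α Q : Type}

/-- Some word acts on the states of `M` as `t`. -/
def Realizes (M : DFA α Q) (t : Q → Q) : Prop := ∃ w, ∀ q, M.evalFrom q w = t q

variable {M : DFA α Q}

theorem Realizes.id : Realizes M id := ⟨[], fun _ => rfl⟩

theorem Realizes.letter (x : α) : Realizes M (M.step · x) := ⟨[x], fun _ => rfl⟩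

theorem Realizes.comp {t u : Q → Q} (hu : Realizes M u) (ht : Realizes M t) :
    Realizes M (u ∘ t) := by
  obtain ⟨v, hv⟩ := hu
  obtain ⟨w, hw⟩ := ht
  exact ⟨w ++ v, fun q => by rw [M.evalFrom_of_append, hw, hv, Function.comp_apply]⟩

theorem Realizes.mul {σ τ : Equiv.Perm Q} (hσ : Realizes M σ) (hτ : Realizes M τ) :
    Realizes M (σ * τ : Equiv.Perm Q) := by
  rw [Equiv.Perm.coe_mul]
  exact hσ.comp hτ

/-- A permutation of a finite set has finite order, so its inverse is a natural power of it. -/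
theorem Realizes.inv [Finite Q] {σ : Equiv.Perm Q} (hσ : Realizes M σ) :
    Realizes M (σ⁻¹ : Equiv.Perm Q) := by
  have hpow : ∀ k : ℕ, Realizes M (σ ^ k : Equiv.Perm Q) := by
    intro k
    induction k with
    | zero => exact Realizes.id
    | succ k ih => rw [pow_succ]; exact ih.mul hσ
  have : σ⁻¹ = σ ^ (orderOf σ - 1) := by
    rw [inv_eq_iff_mul_eq_one, ← pow_succ', Nat.sub_add_cancel (orderOf_pos σ), pow_orderOf_eq_one]
  exact this ▸ hpow _

theorem evalFrom_sink {z : Q} (hz : ∀ x, M.step z x = z) (w : List α) : M.evalFrom z w = z := by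
  induction w with
  | nil => rfl
  | cons x w ih => rw [M.evalFrom_cons, hz, ih]

theorem evalFrom_dichotomy {s z : Q} (hz : ∀ x, M.step z x = z)
    (hs : ∀ x, M.step s x = s ∨ ∀ q, M.step q x = M.step s x ∨ M.step q x = z) (w : List α) :
    M.evalFrom s w = s ∨ ∀ q, M.evalFrom q w = M.evalFrom s w ∨ M.evalFrom q w = z := by
  induction w with
  | nil => exact Or.inl rfl
  | cons x w ih =>
    simp only [M.evalFrom_cons]
    rcases hs x with h1 | h1
    · rw [h1]
      exact ih.imp_right fun h2 q => h2 _
    · refine Or.inr fun q => ?_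
      rcases h1 q with h2 | h2
      · exact Or.inl (by rw [h2])
      · exact Or.inr (by rw [h2, evalFrom_sink hz])

end Generation

/-! ### Generating transformations from transpositions and unitary maps. -/

section Fin

variable {α : Type} {n : ℕ} {M : DFA α (Fin n)}

theorem unitary_swap_conj (p q i j : Fin n) :
    Equiv.swap i j ∘ unitary p q ∘ Equiv.swap i j =
      unitary (Equiv.swap i j p) (Equiv.swap i j q) := by
  funext r
  simp only [Function.comp_apply, unitary]
  by_cases hr : r = Equiv.swap i j p
  · subst hr
    simp
  · rw [if_neg hr, if_neg, Equiv.swap_apply_self]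
    rintro rfl
    simp at hr

/-- If all transpositions of elements of `P` are realized and some `(p → q)` with `p ≠ q` in `P`,
then so are all `(i → j)` with `i ≠ j` in `P`. -/
theorem Realizes.unitary_of_swap {P : Fin n → Prop}
    (hswap : ∀ i j, P i → P j → Realizes M (Equiv.swap i j)) {p q : Fin n} (hp : P p) (hq : P q)
    (hpq : p ≠ q) (h : Realizes M (unitary p q)) {i j : Fin n} (hi : P i) (hj : P j)
    (hij : i ≠ j) : Realizes M (unitary i j) := by
  -- Conjugation moves the source to `i` and the target to some `k`; a second conjugation, by `swap
  -- k j`, moves the target to `j` without disturbing `i`.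
  have h1 := (hswap p i hp hi).comp (h.comp (hswap p i hp hi))
  rw [unitary_swap_conj, Equiv.swap_apply_left] at h1
  have hk : P (Equiv.swap p i q) := by
    rcases eq_or_ne q i with rfl | hqi
    · rwa [Equiv.swap_apply_right]
    · rwa [Equiv.swap_apply_of_ne_of_ne hpq.symm hqi]
  have hki : Equiv.swap p i q ≠ i := fun e => hpq
    ((Equiv.swap p i).injective ((Equiv.swap_apply_left p i).trans e.symm))
  set k := Equiv.swap p i q
  have h2 := (hswap k j hk hj).comp (h1.comp (hswap k j hk hj))
  rwa [unitary_swap_conj, Equiv.swap_apply_left, Equiv.swap_apply_of_ne_of_ne hki.symm hij] at h2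

/-- If all transpositions of elements of `P` are realized and `(p → q)` with `p` in `P` and `q` not
in `P`, then so are all `(i → q)` with `i` in `P`. -/
theorem Realizes.unitary_of_swap_of_not {P : Fin n → Prop}
    (hswap : ∀ i j, P i → P j → Realizes M (Equiv.swap i j)) {p q : Fin n} (hp : P p) (hq : ¬ P q)
    (h : Realizes M (unitary p q)) {i : Fin n} (hi : P i) : Realizes M (unitary i q) := by
  have h1 := (hswap p i hp hi).comp (h.comp (hswap p i hp hi))
  rwa [unitary_swap_conj, Equiv.swap_apply_left, Equiv.swap_apply_of_ne_of_ne] at h1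
  · rintro rfl
    exact hq hp
  · rintro rfl
    exact hq hi

/-- The transformations that fix all elements outside `P` are generated by the transpositions of
elements of `P` and the transformations `(i → j)` with `i` in `P`. -/
theorem Realizes.of_swap_of_unitary {P : Fin n → Prop}
    (hswap : ∀ i j, P i → P j → Realizes M (Equiv.swap i j))
    (hunit : ∀ i j, P i → i ≠ j → Realizes M (unitary i j)) (t : Fin n → Fin n)
    (ht : ∀ i, ¬ P i → t i = i) : Realizes M t := by
  -- Induction on the number of moved points. Given a moved `i = t x`, the map `swap i x ∘ t` fixes
  -- `x` as well as every fixed point of `t`. If `i` is not in the image, `t` is `(i → t i)` after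
  -- the map that agrees with `t` except for fixing `i`.
  induction hk : (Finset.univ.filter fun i => t i ≠ i).card using Nat.strong_induction_on
    generalizing t with
  | _ k ih =>
  by_cases hid : ∀ i, t i = i
  · rw [show t = _root_.id from funext hid]
    exact Realizes.id
  push Not at hid
  obtain ⟨i, hi⟩ := hid
  have hPi : P i := by_contra fun hn => hi (ht i hn)
  by_cases himg : ∃ x, t x = i
  · obtain ⟨x, hx⟩ := himg
    have hxi : x ≠ i := by
      rintro rfl
      exact hi hx
    have hPx : P x := by_contra fun hn => hxi ((ht x hn).symm.trans hx)
    have hfix : ∀ y, t y = y → Equiv.swap i x (t y) = y := by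
      intro y hy
      rw [hy]
      refine Equiv.swap_apply_of_ne_of_ne ?_ ?_
      · rintro rfl
        exact hi hy
      · rintro rfl
        exact hxi (hy.symm.trans hx)
    have h1 : Realizes M (Equiv.swap i x ∘ t) := by
      refine ih _ ?_ _ (fun y hy => hfix y (ht y hy)) rfl
      rw [← hk]
      refine Finset.card_lt_card (Finset.ssubset_iff_of_subset ?_ |>.2 ⟨x, ?_, ?_⟩)
      · intro y hy
        simp only [Finset.mem_filter, Finset.mem_univ, true_and, Function.comp_apply] at hy ⊢
        exact fun e => hy (hfix y e)
      · simp [hx, hxi.symm]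
      · simp [hx]
    have h2 := (hswap i x hPi hPx).comp h1
    rwa [← Function.comp_assoc, ← Equiv.coe_trans, Equiv.swap_swap, Equiv.coe_refl,
      Function.id_comp] at h2
  · push Not at himg
    have h1 : Realizes M (Function.update t i i) := by
      refine ih _ ?_ _ (fun y hy => ?_) rfl
      · rw [← hk]
        refine Finset.card_lt_card (Finset.ssubset_iff_of_subset ?_ |>.2 ⟨i, ?_, ?_⟩)
        · intro y hy
          simp only [Finset.mem_filter, Finset.mem_univ, true_and] at hy ⊢
          rcases eq_or_ne y i with rfl | hyi
          · exact hi
          · rwa [Function.update_of_ne hyi] at hy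
        · simpa using hi
        · simp
      · rw [Function.update_of_ne, ht y hy]
        rintro rfl
        exact hy hPi
    have h2 := (hunit i (t i) hPi hi.symm).comp h1
    convert h2 using 1
    funext y
    rcases eq_or_ne y i with rfl | hyi
    · simp [unitary]
    · simp [unitary, Function.update_of_ne hyi, himg y]

end Fin

/-! ### The automata with two and three states. -/

theorem isRich_dfa2 : IsRich dfa2 (state 2 2 (by omega)) where
  accept_eq := rfl
  start_ne := by decide
  sink := evalFrom_sink (by rintro (_ | _) <;> decide)
  dichotomy := evalFrom_dichotomy (by rintro (_ | _) <;> decide) (by rintro (_ | _) <;> decide)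
  full t h1 h2 := ⟨[], fun q => by
    fin_cases q
    · exact h1.symm
    · exact h2.symm⟩
  collapse j := by
    fin_cases j
    · exact ⟨[], by decide⟩
    · exact ⟨[.b], by decide⟩

theorem isRich_dfa3 : IsRich dfa3 (state 3 3 (by omega)) where
  accept_eq := rfl
  start_ne := by decide
  sink := evalFrom_sink (by rintro (_ | _ | _ | _) <;> decide)
  dichotomy := evalFrom_dichotomy (by rintro (_ | _ | _ | _) <;> decide)
    (by rintro (_ | _ | _ | _) <;> decide)
  full t h1 h2 := by
    -- Only the middle state is free, and `d`, the empty word and `c` realize its three possible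
    -- images.
    have key : ∀ w : List Letters4, dfa3.evalFrom 0 w = 0 → dfa3.evalFrom 1 w = t 1 →
        dfa3.evalFrom 2 w = 2 → ∃ w, ∀ q, dfa3.evalFrom q w = t q := by
      refine fun w e1 e2 e3 => ⟨w, fun q => ?_⟩
      fin_cases q
      · exact e1.trans h1.symm
      · exact e2
      · exact e3.trans h2.symm
    have ht : t 1 = 0 ∨ t 1 = 1 ∨ t 1 = 2 := by
      generalize t 1 = r
      revert r
      decide
    rcases ht with ht | ht | ht
    · exact key [.d] (by decide) (ht ▸ by decide) (by decide)
    · exact key [] rfl ht.symm rfl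
    · exact key [.c] (by decide) (ht ▸ by decide) (by decide)
  collapse j := by
    fin_cases j
    · exact ⟨[.b, .d], by decide⟩
    · exact ⟨[.b], by decide⟩
    · exact ⟨[.b, .c], by decide⟩

/-! ### The automata with at least four states. -/

section Large

variable {n : ℕ}

theorem cycle_injective (hn : 4 ≤ n) :
    Function.Injective (cycle (state n 2 (by omega)) (state n (n - 1) (by omega))) := by
  intro i j hij
  have hv := congrArg Fin.val hij
  simp only [cycle, state, Fin.le_def, Fin.lt_def, Fin.ext_iff] at hv ⊢
  split_ifs at hv <;> try dsimp only at hv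
  all_goals omega

theorem realizes_adjacent_swap (hn : 4 ≤ n) (k : ℕ) (h1 : 1 ≤ k) (h2 : k + 1 < n - 1) :
    Realizes (dfaLarge n hn) (Equiv.swap (⟨k, by omega⟩ : Fin n) ⟨k + 1, by omega⟩) := by
  let σ : Equiv.Perm (Fin n) :=
    Equiv.ofBijective _ (Finite.injective_iff_bijective.1 (cycle_injective hn))
  have hσ : Realizes (dfaLarge n hn) σ := Realizes.letter Letters6.a
  have happ : ∀ k (h1 : 1 ≤ k) (h2 : k < n - 2), σ ⟨k, by omega⟩ = ⟨k + 1, by omega⟩ := by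
    intro k h1 h2
    have hc : state n 2 (by omega) ≤ (⟨k, by omega⟩ : Fin n) ∧
        (⟨k, by omega⟩ : Fin n) < state n (n - 1) (by omega) := by
      simp only [state, Fin.le_def, Fin.lt_def]
      omega
    exact dif_pos hc
  induction k, h1 using Nat.le_induction with
  | base => exact Realizes.letter Letters6.b
  | succ k h1 ih =>
    -- Conjugating by the cycle `a` shifts an adjacent transposition by one place; letter `b` is the
    -- first of them.
    have := (hσ.mul (ih (by omega) happ)).mul hσ.inv
    rwa [← Equiv.swap_apply_apply, happ k h1 (by omega), happ (k + 1) (by omega) (by omega)] at this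

theorem realizes_swap (hn : 4 ≤ n) (i j : Fin n) (hi : 1 ≤ i.val ∧ i.val < n - 1)
    (hj : 1 ≤ j.val ∧ j.val < n - 1) : Realizes (dfaLarge n hn) (Equiv.swap i j) := by
  have key : ∀ i j : ℕ, (h1 : 1 ≤ i) → (hij : i < j) → (h2 : j < n - 1) →
      Realizes (dfaLarge n hn) (Equiv.swap (⟨i, by omega⟩ : Fin n) ⟨j, by omega⟩) := by
    intro i j h1 hij
    induction j, hij using Nat.le_induction with
    | base => exact fun h2 => realizes_adjacent_swap hn i h1 h2
    | succ j hij ih =>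
      intro h2
      have hadj := realizes_adjacent_swap hn j (by omega) h2
      -- Conjugating `(i j)` by `(j j+1)` gives `(i j+1)`.
      have := (hadj.mul (ih (by omega))).mul hadj
      rwa [Equiv.swap_mul_swap_mul_swap, Equiv.swap_comm] at this
      · simp only [ne_eq, Fin.ext_iff]
        omega
      · simp only [ne_eq, Fin.ext_iff]
        omega
  rcases lt_trichotomy i.val j.val with h | h | h
  · exact key i j hi.1 h hj.2
  · rw [Fin.ext h, Equiv.swap_self]
    exact Realizes.id
  · rw [Equiv.swap_comm]
    exact key j i hj.1 h hi.2

theorem realizes_of_fixes (hn : 4 ≤ n) (t : Fin n → Fin n) (h1 : t (state n 1 (by omega)) = state n 1 (by omega))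
    (h2 : t (state n n (by omega)) = state n n (by omega)) : Realizes (dfaLarge n hn) t := by
  have hswap := realizes_swap hn
  have hends : ∀ i : Fin n, ¬ (1 ≤ i.val ∧ i.val < n - 1) →
      i = state n 1 (by omega) ∨ i = state n n (by omega) := by
    intro i hi
    simp only [state, Fin.ext_iff]
    omega
  refine Realizes.of_swap_of_unitary (P := fun i => 1 ≤ i.val ∧ i.val < n - 1) hswap ?_ t ?_
  · intro i j hi hij
    -- Letters `c`, `d`, `f` seed the unitary maps whose target is a middle state, the start and the
    -- sink respectively.
    by_cases hj : 1 ≤ j.val ∧ j.val < n - 1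
    · refine Realizes.unitary_of_swap (P := fun i => 1 ≤ i.val ∧ i.val < n - 1) hswap
        (p := state n (n - 1) (by omega)) (q := state n 2 (by omega)) ?_ ?_ ?_
        (Realizes.letter Letters6.c) hi hj hij <;> simp only [state, ne_eq, Fin.ext_iff] <;> omega
    rcases hends j hj with rfl | rfl
    · refine Realizes.unitary_of_swap_of_not (P := fun i => 1 ≤ i.val ∧ i.val < n - 1) hswap
        (p := state n (n - 1) (by omega)) ?_ hj (Realizes.letter Letters6.d) hi
      simp only [state]
      omega
    · refine Realizes.unitary_of_swap_of_not (P := fun i => 1 ≤ i.val ∧ i.val < n - 1) hswap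
        (p := state n 2 (by omega)) ?_ hj (Realizes.letter Letters6.f) hi
      simp only [state]
      omega
  · intro i hi
    rcases hends i hi with rfl | rfl
    · exact h1
    · exact h2

theorem isRich_dfaLarge (hn : 4 ≤ n) : IsRich (dfaLarge n hn) (state n n (by omega)) := by
  have hz : ∀ x, (dfaLarge n hn).step (state n n (by omega)) x = state n n (by omega) := by
    intro x
    cases x
    · change cycle _ _ _ = _
      rw [cycle, dif_neg, if_neg] <;> simp only [state, Fin.le_def, Fin.lt_def, Fin.ext_iff] <;> omega
    · refine Equiv.swap_apply_of_ne_of_ne ?_ ?_ <;> simp only [state, ne_eq, Fin.ext_iff] <;> omega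
    · refine if_neg ?_
      simp only [state, Fin.ext_iff]
      omega
    · refine if_neg ?_
      simp only [state, Fin.ext_iff]
      omega
    · refine if_neg ?_
      simp only [state]
      omega
    · refine if_neg ?_
      simp only [state, Fin.ext_iff]
      omega
  have hcoll : ∀ q, q ≠ state n n (by omega) →
      (dfaLarge n hn).step q Letters6.e = state n 2 (by omega) := by
    intro q hq
    refine if_pos ?_
    simp only [state, ne_eq, Fin.ext_iff] at hq
    omega
  have hs : ∀ x, (dfaLarge n hn).step (state n 1 (by omega)) x = state n 1 (by omega) ∨
      ∀ q, (dfaLarge n hn).step q x = (dfaLarge n hn).step (state n 1 (by omega)) x ∨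
        (dfaLarge n hn).step q x = state n n (by omega) := by
    intro x
    cases x
    · left
      change cycle (state n 2 (by omega)) (state n (n - 1) (by omega)) (state n 1 (by omega)) = _
      rw [cycle, dif_neg, if_neg] <;> simp only [state, Fin.le_def, Fin.lt_def, Fin.ext_iff] <;> omega
    · left
      refine Equiv.swap_apply_of_ne_of_ne ?_ ?_ <;> simp only [state, ne_eq, Fin.ext_iff] <;> omega
    · left
      refine if_neg ?_
      simp only [state, Fin.ext_iff]
      omega
    · left
      refine if_neg ?_
      simp only [state, Fin.ext_iff]
      omega
    · right
      intro q
      rcases eq_or_ne q (state n n (by omega)) with rfl | hq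
      · exact Or.inr (hz _)
      · left
        rw [hcoll q hq, hcoll]
        simp only [state, ne_eq, Fin.ext_iff]
        omega
    · left
      change unitary (state n 2 (by omega)) (state n n (by omega)) (state n 1 (by omega)) = _
      refine if_neg ?_
      simp only [state, Fin.ext_iff]
      omega
  refine ⟨rfl, ?_, evalFrom_sink hz, evalFrom_dichotomy hz hs, realizes_of_fixes hn, fun j => ?_⟩
  · change state n 1 (by omega) ≠ _
    simp only [state, ne_eq, Fin.ext_iff]
    omega
  · obtain ⟨w, hw⟩ := realizes_of_fixes hn (unitary (state n 2 (by omega)) j)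
      (if_neg (by simp only [state, Fin.ext_iff]; omega))
      (if_neg (by simp only [state, Fin.ext_iff]; omega))
    refine ⟨Letters6.e :: w, fun q hq => ?_⟩
    rw [DFA.evalFrom_cons, hcoll q hq, hw]
    exact if_pos rfl

end Large

/-! ### Assembly for all `n`. -/

theorem dfa_start : ∀ (n : ℕ) (hn : 2 ≤ n), (dfa n hn).start = state n 1 (by omega)
  | 0, h => absurd h (by omega)
  | 1, h => absurd h (by omega)
  | 2, _ => rfl
  | 3, _ => rfl
  | _ + 4, _ => rfl

theorem isRich_dfa : ∀ (n : ℕ) (hn : 2 ≤ n), IsRich (dfa n hn) (state n n (by omega))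
  | 0, h => absurd h (by omega)
  | 1, h => absurd h (by omega)
  | 2, _ => isRich_dfa2
  | 3, _ => isRich_dfa3
  | _ + 4, _ => isRich_dfaLarge (by omega)

end TwoSidedAtoms

theorem mainTheorem2 (n : ℕ) (hn : 2 ≤ n) :
    TwoSidedAtoms.IsTwoSidedIdeal (TwoSidedAtoms.dfa n hn).accepts ∧
    TwoSidedAtoms.complexity (TwoSidedAtoms.dfa n hn).accepts = (n : ℕ∞) ∧
    Function.Injective (TwoSidedAtoms.dfa n hn).acceptsFrom ∧
    Set.range (TwoSidedAtoms.dfa n hn).acceptsFrom =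
      TwoSidedAtoms.quotients (TwoSidedAtoms.dfa n hn).accepts ∧
    {A | TwoSidedAtoms.IsAtomOf (TwoSidedAtoms.dfa n hn).accepts A}.encard =
      ((2 ^ (n - 2) + 1 : ℕ) : ℕ∞) ∧
    ∀ S : Finset (Fin n),
      TwoSidedAtoms.IsAtomOf (TwoSidedAtoms.dfa n hn).accepts
        (TwoSidedAtoms.atomicIntersection (TwoSidedAtoms.dfa n hn).acceptsFrom (S : Set (Fin n))) →
      TwoSidedAtoms.complexity
        (TwoSidedAtoms.atomicIntersection (TwoSidedAtoms.dfa n hn).acceptsFrom (S : Set (Fin n))) =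
          (TwoSidedAtoms.atomBound n hn S : ℕ∞) := by
  have h := TwoSidedAtoms.isRich_dfa n hn
  refine ⟨h.isTwoSidedIdeal, ?_, h.acceptsFrom_injective, h.range_acceptsFrom, ?_, ?_⟩
  · rw [h.complexity_accepts, Fintype.card_fin]
  · rw [h.encard_atoms, Fintype.card_fin]
  · intro S hS
    rw [TwoSidedAtoms.atomBound, ← TwoSidedAtoms.dfa_start n hn]
    split_ifs with h1 h2
    · rw [h1, h.complexity_univ, Fintype.card_fin]
    · rw [h2, h.complexity_univ_sdiff_start, Fintype.card_fin]
      have := Nat.one_le_two_pow (n := n - 2)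
      exact congrArg Nat.cast (by omega)
    · rcases h.nonempty_atomicIntersection_iff.1 hS.1 with hu | ⟨hz, hs⟩
      · exact absurd (Finset.coe_eq_univ.1 hu) h1
      · have hs' : (TwoSidedAtoms.dfa n hn).start ∈ Sᶜ := Finset.mem_compl.2 hs
        rw [h.complexity_of_two_le_card_compl hz hs, Fintype.card_fin]
        -- The start lies in `Sᶜ`; with fewer than two elements there, `S` would be the case
        -- excluded by `h2`.
        by_contra hlt
        refine h2 ?_
        rw [← Finset.compl_eq_univ_sdiff, eq_compl_comm]
        exact Finset.eq_of_subset_of_card_le (Finset.singleton_subset_iff.2 hs')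
          (by rw [Finset.card_singleton]; omega)
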